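/- Let $G$ be a finite group, $z\in G$ an element of order $o(z)$, and $C_G(z)$ its centralizer, with exponent $\exp(C_G(z))$. For an integer $m$ let $\gamma_m^z\colon C_G(z)\to\mathbb C$ be the class function $$\gamma_m^z(g)=\bigl|\{x\in G \mid x^m=(gx)^m=z\}\bigr| ,$$ and let $\beta_m(z,\chi)\in\mathbb C$, for $\chi$ in the set $\operatorname{Irr}(C_G(z))$ of irreducible complex characters of $C_G(z)$, be the coefficients of its (unique) expansion $$\gamma_m^z=\sum_{\chi\in\operatorname{Irr}(C_G(z))}\beta_m(z,\chi)\,\chi .$$ Suppose that the integer $m$ divides $\exp(C_G(z))/o(z)$, and let $d=\gcd(o(z),m)$. Then for every $\chi\in\operatorname{Irr}(C_G(z))$ one has $\beta_m(z,\chi)\in\mathbb Q(\zeta_d)$, where $\zeta_d=e^{2\pi i/d}$. In particular, if $d\in\{1,2,3,4,6\}$, then $\beta_m(z,\chi)\in\mathbb Q$. -/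

import Mathlib

open scoped MonoidAlgebra

noncomputable section

namespace FSIndicator

section ClassFunctions

variable (H : Type*) [Group H]

/-- The space of complex class functions on a group `H`. -/
def ClassFunction : Submodule ℂ (H → ℂ) where
  carrier := {f | ∀ t g : H, f (t * g * t⁻¹) = f g}
  add_mem' := by
    intro a b ha hb t g
    simp [ha t g, hb t g]
  zero_mem' := by
    intro t g
    rfl
  smul_mem' := by
    intro c a ha t g
    simp [ha t g]

/-- `Irr(H)`: the set of characters of the irreducible finite-dimensional complex
representations of `H` (each of which can be realised on some `ℂⁿ`). -/
def Irr : Set (H → ℂ) :=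
  {χ | ∃ (n : ℕ) (ρ : Representation ℂ H (Fin n → ℂ)), ρ.IsIrreducible ∧ χ = ρ.character}

/-- An irreducible character, as an element of the space of class functions. -/
def irrClassFunction (χ : Irr H) : ClassFunction H :=
  ⟨χ.1, by
    obtain ⟨n, ρ, -, h⟩ := χ.2
    intro t g
    rw [h, ρ.char_conj]⟩

end ClassFunctions

section Basis

variable {H : Type*} [Group H]

/-- The functional `f ↦ |H|⁻¹ ∑_g f(g) χ(g⁻¹)`. -/
def pairing [Fintype H] (χ : H → ℂ) : (H → ℂ) →ₗ[ℂ] ℂ where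
  toFun f := (Nat.card H : ℂ)⁻¹ * ∑ g : H, f g * χ g⁻¹
  map_add' f f' := by
    simp only [Pi.add_apply, add_mul, Finset.sum_add_distrib, mul_add]
  map_smul' c f := by
    simp only [Pi.smul_apply, smul_eq_mul, RingHom.id_apply, mul_assoc, ← Finset.mul_sum]
    ring

open Classical in
theorem pairing_irr [Fintype H] (χ ψ : Irr H) :
    pairing ψ.1 χ.1 = if χ = ψ then 1 else 0 := by
  obtain ⟨χ, n, ρ, hρ, rfl⟩ := χ
  obtain ⟨ψ, k, σ, hσ, rfl⟩ := ψ
  have : Invertible (Nat.card H : ℂ) := invertibleOfNonzero (by simp)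
  have h1 := Representation.char_orthonormal ρ σ
  have h2 := Representation.char_orthonormal ρ ρ
  change (Nat.card H : ℂ)⁻¹ * ∑ g : H, ρ.character g * σ.character g⁻¹ = _
  by_cases he : Nonempty (Representation.Equiv σ ρ)
  · rw [h1, if_pos he, if_pos]
    exact Subtype.ext (Representation.char_iso he.some).symm
  · have hne : ρ.character ≠ σ.character := by
      intro h
      rw [← h, h2, if_pos ⟨Representation.Equiv.refl ρ⟩, if_neg he] at h1
      exact one_ne_zero h1
    rw [h1, if_neg he, if_neg]
    intro h
    exact hne (congrArg Subtype.val h)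

theorem linearIndependent_irr [Finite H] :
    LinearIndependent ℂ (irrClassFunction H) := by
  classical
  have := Fintype.ofFinite H
  rw [linearIndependent_iff']
  intro s c hc ψ hψ
  have h := congrArg (fun f : ClassFunction H => pairing ψ.1 f.1) hc
  simp only [Submodule.coe_sum, Submodule.coe_smul, map_sum, map_smul, Submodule.coe_zero,
    map_zero, smul_eq_mul] at h
  have h' : ∀ χ ∈ s, c χ * pairing ψ.1 (irrClassFunction H χ).1 = if χ = ψ then c χ else 0 := by
    intro χ _
    change c χ * pairing ψ.1 χ.1 = _
    rw [pairing_irr]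
    split_ifs <;> simp
  rw [Finset.sum_congr rfl h', Finset.sum_ite_eq' s ψ c, if_pos hψ] at h
  exact h

/-- A class function orthogonal to an irreducible character acts as zero on the
corresponding representation. -/
theorem sum_smul_eq_zero [Fintype H] {n : ℕ} (ρ : Representation ℂ H (Fin n → ℂ))
    (hρ : ρ.IsIrreducible) (f : ClassFunction H)
    (hf : ∑ g : H, f.1 g * ρ.character g⁻¹ = 0) :
    ∑ g : H, f.1 g • ρ g⁻¹ = 0 := by
  let T : Representation.IntertwiningMap ρ ρ :=
    { toLinearMap := ∑ g : H, f.1 g • ρ g⁻¹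
      isIntertwining' := by
        intro t
        have : (∑ g : H, f.1 g • ρ g⁻¹) * ρ t = ρ t * ∑ g : H, f.1 g • ρ g⁻¹ := by
          rw [Finset.sum_mul, Finset.mul_sum]
          refine Fintype.sum_equiv (MulAut.conj t⁻¹).toEquiv _ _ ?_
          intro g
          have e : (MulAut.conj t⁻¹).toEquiv g = t⁻¹ * g * t⁻¹⁻¹ := rfl
          rw [e, f.2 t⁻¹ g, smul_mul_assoc, mul_smul_comm, ← map_mul, ← map_mul]
          congr 2
          group
        exact this }
  obtain ⟨c, hc⟩ :=
    (Representation.IsIrreducible.algebraMap_intertwiningMap_bijective_of_isAlgClosed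
      (ρ := ρ)).2 T
  have hT : ∑ g : H, f.1 g • ρ g⁻¹ = c • LinearMap.id := by
    have := congrArg Representation.IntertwiningMap.toLinearMap hc
    exact this.symm
  have htr := congrArg (LinearMap.trace ℂ (Fin n → ℂ)) hT
  rw [map_sum] at htr
  simp only [map_smul, smul_eq_mul, LinearMap.trace_id] at htr
  have h0 : c * (Module.finrank ℂ (Fin n → ℂ) : ℂ) = 0 := htr.symm.trans hf
  have hn : (Module.finrank ℂ (Fin n → ℂ) : ℂ) ≠ 0 := by
    have h1 := Representation.IsIrreducible.finrank_intertwiningMap_self ρ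
    intro h
    have hn0 : n = 0 := by simpa using h
    subst hn0
    have : Subsingleton (Representation.IntertwiningMap ρ ρ) :=
      ⟨fun a b => by ext v i; exact i.elim0⟩
    rw [Module.finrank_zero_of_subsingleton] at h1
    omega
  rw [hT, (mul_eq_zero.1 h0).resolve_right hn, zero_smul]

/-- A simple module over the group algebra of a finite group is killed by a class function
orthogonal to all irreducible characters. -/
theorem smul_simple_eq_zero [Fintype H] (f : ClassFunction H)
    (hf : ∀ χ : Irr H, ∑ g : H, f.1 g * χ.1 g⁻¹ = 0)
    (S : Submodule ℂ[H] ℂ[H]) [IsSimpleModule ℂ[H] S] (x : S) :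
    (∑ g : H, MonoidAlgebra.single g⁻¹ (f.1 g)) • x = 0 := by
  have : Module.Finite ℂ ℂ[H] := inferInstance
  have : FiniteDimensional ℂ S :=
    FiniteDimensional.finiteDimensional_submodule (S.restrictScalars ℂ)
  let e : S ≃ₗ[ℂ] (Fin (Module.finrank ℂ S) → ℂ) := (Module.finBasis ℂ S).equivFun
  let ρ : Representation ℂ H (Fin (Module.finrank ℂ S) → ℂ) :=
    { toFun := fun g => e.conj (Representation.ofModule' (k := ℂ) (G := H) S g)
      map_one' := by
        rw [map_one]
        exact e.conj_id
      map_mul' := by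
        intro a b
        ext v
        simp [LinearEquiv.conj_apply] }
  have hρ : ∀ g y, ρ g (e y) = e (MonoidAlgebra.single g (1 : ℂ) • y) := by
    intro g y
    change e (Representation.ofModule' (k := ℂ) (G := H) S g (e.symm (e y))) = _
    rw [e.symm_apply_apply]
    rfl
  have hsm : ∀ (c : ℂ) (g : H) (y : S), MonoidAlgebra.single g c • y =
      c • (MonoidAlgebra.single g (1 : ℂ) • y) := by
    intro c g y
    rw [← smul_assoc, MonoidAlgebra.smul_single, smul_eq_mul, mul_one]
  let E : ρ.asModule ≃ₗ[ℂ[H]] S := LinearEquiv.symm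
    { toFun := fun y => ρ.asModuleEquiv.symm (e y)
      map_add' := by intro a b; simp
      map_smul' := by
        intro a y
        induction a using MonoidAlgebra.induction_linear with
        | zero => simp
        | add a b ha hb =>
          simp only [RingHom.id_apply] at ha hb
          simp only [add_smul, map_add, ha, hb, RingHom.id_apply]
        | single g c =>
          rw [hsm, map_smul, ← hρ]
          simp only [RingHom.id_apply]
          rw [Representation.single_smul]
          rfl
      invFun := fun v => e.symm (ρ.asModuleEquiv v)
      left_inv := by intro y; simp
      right_inv := by intro y; simp }
  have hirr : ρ.IsIrreducible :=
    (Representation.irreducible_iff_isSimpleModule_asModule ρ).2 (IsSimpleModule.congr E)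
  have h0 := sum_smul_eq_zero ρ hirr f (hf ⟨ρ.character, _, ρ, hirr, rfl⟩)
  have h1 := congrArg (fun L => L (e x)) h0
  simp only [LinearMap.sum_apply, LinearMap.smul_apply, hρ, LinearMap.zero_apply,
    ← map_smul, ← map_sum] at h1
  rw [Finset.sum_smul]
  simp only [hsm (f.1 _)]
  exact e.map_eq_zero_iff.1 h1

theorem eq_zero_of_orthogonal [Fintype H] (f : ClassFunction H)
    (hf : ∀ χ : Irr H, ∑ g : H, f.1 g * χ.1 g⁻¹ = 0) : f = 0 := by
  have hN : NeZero (Nat.card H : ℂ) := ⟨by simp⟩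
  set a : ℂ[H] := ∑ g : H, MonoidAlgebra.single g⁻¹ (f.1 g) with ha
  have key : ∀ x : ℂ[H], a * x = 0 := by
    intro x
    have hx : x ∈ sSup {S : Submodule ℂ[H] ℂ[H] | IsSimpleModule ℂ[H] S} := by
      rw [IsSemisimpleModule.sSup_simples_eq_top]
      trivial
    rw [sSup_eq_iSup'] at hx
    refine Submodule.iSup_induction _ (motive := fun x => a * x = 0) hx ?_ (mul_zero a) ?_
    · rintro ⟨S, hS⟩ y hy
      have : IsSimpleModule ℂ[H] S := hS
      exact congrArg Subtype.val (smul_simple_eq_zero f hf S ⟨y, hy⟩)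
    · intro y z hy hz
      rw [mul_add, hy, hz, add_zero]
  have h1 := key 1
  rw [mul_one] at h1
  ext g
  have h2 := congrArg (fun b : ℂ[H] => b.coeff g⁻¹) h1
  classical
  simpa [ha, Finsupp.finsetSum_apply, Finsupp.single_apply] using h2

theorem span_irr [Finite H] : ⊤ ≤ Submodule.span ℂ (Set.range (irrClassFunction H)) := by
  classical
  have := Fintype.ofFinite H
  have : Finite (Irr H) := (linearIndependent_irr (H := H)).finite
  have := Fintype.ofFinite (Irr H)
  intro f _
  have h : f - ∑ χ : Irr H, pairing χ.1 f.1 • irrClassFunction H χ = 0 := by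
    apply eq_zero_of_orthogonal
    intro ψ
    have h1 : pairing ψ.1 (f - ∑ χ : Irr H, pairing χ.1 f.1 • irrClassFunction H χ).1 = 0 := by
      simp only [Submodule.coe_sub, Submodule.coe_sum, Submodule.coe_smul, map_sub, map_sum,
        map_smul, smul_eq_mul]
      have h' : ∀ χ ∈ (Finset.univ : Finset (Irr H)),
          pairing χ.1 f.1 * pairing ψ.1 (irrClassFunction H χ).1 =
            if χ = ψ then pairing χ.1 f.1 else 0 := by
        intro χ _
        change _ * pairing ψ.1 χ.1 = _
        rw [pairing_irr]
        split_ifs <;> simp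
      rw [Finset.sum_congr rfl h', Finset.sum_ite_eq' Finset.univ ψ, if_pos (Finset.mem_univ _),
        sub_self]
    exact (mul_eq_zero.1 h1).resolve_left (by simp)
  rw [sub_eq_zero.1 h]
  exact Submodule.sum_mem _ fun χ _ =>
    Submodule.smul_mem _ _ (Submodule.subset_span ⟨χ, rfl⟩)

variable (H) in
/-- The irreducible characters of a finite group form a basis of its class functions. -/
def irrBasis [Finite H] : Module.Basis (Irr H) ℂ (ClassFunction H) :=
  Module.Basis.mk linearIndependent_irr span_irr

end Basis

section Indicators

variable {G : Type*} [Group G]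

/-- The set `G_m(g, z) = {x ∈ G | x ^ m = (g x) ^ m = z}`. -/
def powSet (m : ℤ) (g z : G) : Set G :=
  {x | x ^ m = z ∧ (g * x) ^ m = z}

/-- The class function `γ_m^z : C_G(z) → ℂ`, `g ↦ |G_m(g, z)|`. -/
def gammaFun (m : ℤ) (z : G) : ClassFunction (Subgroup.centralizer {z}) :=
  ⟨fun g => (Nat.card (powSet m (g : G) z) : ℂ), by
    intro t g
    have ht : (t : G) * z * (t : G)⁻¹ = z := by
      have := Subgroup.mem_centralizer_iff.1 t.2 z rfl
      rw [← this, mul_inv_cancel_right]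
    have hp : ∀ y : G, ((t : G) * y * (t : G)⁻¹) ^ m = z ↔ y ^ m = z := by
      intro y
      rw [conj_zpow]
      constructor
      · intro h
        exact mul_left_cancel (mul_right_cancel (h.trans ht.symm))
      · intro h
        rw [h, ht]
    refine congrArg _ (Nat.card_congr (Equiv.subtypeEquiv (MulAut.conj (t : G)).toEquiv ?_)).symm
    intro x
    have e : ((t * g * t⁻¹ : Subgroup.centralizer {z}) : G) * ((t : G) * x * (t : G)⁻¹) =
        (t : G) * (g * x) * (t : G)⁻¹ := by
      push_cast
      group
    change (x ^ m = z ∧ (g * x : G) ^ m = z) ↔ (((t : G) * x * (t : G)⁻¹) ^ m = z ∧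
      (((t * g * t⁻¹ : Subgroup.centralizer {z}) : G) * ((t : G) * x * (t : G)⁻¹)) ^ m = z)
    rw [e, hp, hp]⟩

/-- `β_m(z, χ)`: the coefficient of `χ` in the expansion of `γ_m^z` in terms of the irreducible
characters of `C_G(z)`. -/
def beta [Finite G] (m : ℤ) (z : G) (χ : Irr (Subgroup.centralizer {z})) : ℂ :=
  (irrBasis (Subgroup.centralizer {z})).repr (gammaFun m z) χ

theorem gammaFun_eq_finsum [Finite G] (m : ℤ) (z : G) (g : Subgroup.centralizer {z}) :
    (gammaFun m z).1 g =
      ∑ᶠ χ : Irr (Subgroup.centralizer {z}), beta m z χ * χ.1 g := by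
  have : Finite (Irr (Subgroup.centralizer {z})) := (linearIndependent_irr).finite
  have := Fintype.ofFinite (Irr (Subgroup.centralizer {z}))
  have h := congrArg (fun f => f.1 g) ((irrBasis (Subgroup.centralizer {z})).sum_repr
    (gammaFun m z))
  rw [finsum_eq_sum_of_fintype, ← h]
  simp only [Submodule.coe_sum, Submodule.coe_smul, Finset.sum_apply, Pi.smul_apply, smul_eq_mul]
  refine Finset.sum_congr rfl fun χ _ => ?_
  rw [irrBasis, Module.Basis.mk_apply]
  rfl

end Indicators

/-- The cyclotomic field `ℚ(ζ_n) ⊆ ℂ`, `ζ_n = exp(2πi/n)`. -/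
def cyclotomicField (n : ℕ) : IntermediateField ℚ ℂ :=
  IntermediateField.adjoin ℚ {Complex.exp (2 * Real.pi * Complex.I / n)}

end FSIndicator

end

/-! Every `m`-th root of `z` commutes with `z`, so the count takes place in `H = C_G(z)`, where `z`
is central. Orthogonality turns `β_m(z, χ)` into `|H|⁻¹` times the sum of `χ(x y⁻¹)` over pairs of
`m`-th roots of `z`. The sum of `ρ(y⁻¹)` over these roots is scalar by Schur's lemma, so the double
sum factors as `χ(1)⁻¹ N(z)`, with `N(z)` the `rootNorm` (`beta_eq_rootNorm`).

A Galois automorphism raising roots of unity of order dividing `exp(H)` to the `r`-th power carries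
`χ(x)` to `χ(x ^ r)`, hence `N(z)` to `N(z ^ r)` (`rootNorm_mem`). If it fixes `ζ_d`, then `d ∣ r -
1`, and Bézout writes `z ^ (r - 1)` as `c ^ m` with `c` a power of `z`. Translating roots by the
central `c` multiplies the two factors of `N` by inverse scalars, so `N(z ^ r) = N(z)`
(`rootNorm_pow`). Since also `N(z⁻¹) = N(z)`, `r ≡ -1` mod `d` works as well; for `d ∈ {1, 2, 3, 4,
6}` all units mod `d` are `±1`, whence rationality. -/

noncomputable section

namespace FSIndicator

/-! ### Galois action on character values -/

section GaloisAction

/-- The trace of a power of an endomorphism of finite order, in terms of its eigenvalues. -/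
theorem trace_pow_eq_sum {V : Type*} [AddCommGroup V] [Module ℂ V] [FiniteDimensional ℂ V]
    (A : Module.End ℂ V) {e : ℕ} (he : 0 < e) (hA : A ^ e = 1) :
    ∃ (S : Finset ℂ) (a : ℂ → ℕ), (∀ μ ∈ S, μ ^ e = 1) ∧
      ∀ k : ℕ, LinearMap.trace ℂ V (A ^ k) = ∑ μ ∈ S, (a μ : ℂ) * μ ^ k := by
  have hss : A.IsSemisimple := by
    refine Module.End.isSemisimple_of_squarefree_aeval_eq_zero
      (p := (Polynomial.X ^ e - 1 : Polynomial ℂ)) ?_ (by simp [hA])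
    exact (Polynomial.X_pow_sub_one_separable_iff.2 (by exact_mod_cast he.ne')).squarefree
  have hint : DirectSum.IsInternal A.eigenspace :=
    (DirectSum.isInternal_submodule_iff_iSupIndep_and_iSup_eq_top _).2
      ⟨A.eigenspaces_iSupIndep, hss.iSup_eigenspace_eq_top⟩
  have hfin : {μ | A.eigenspace μ ≠ ⊥}.Finite :=
    WellFoundedGT.finite_ne_bot_of_iSupIndep A.eigenspaces_iSupIndep
  have hpow : ∀ (k : ℕ) (μ : ℂ) (v : V), v ∈ A.eigenspace μ → (A ^ k) v = μ ^ k • v := by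
    intro k μ v hv
    rw [Module.End.mem_eigenspace_iff] at hv
    induction k with
    | zero => simp
    | succ k ih => rw [pow_succ, Module.End.mul_apply, hv, map_smul, ih, smul_smul, pow_succ']
  refine ⟨hfin.toFinset, fun μ => Module.finrank ℂ (A.eigenspace μ), ?_, ?_⟩
  · intro μ hμ
    obtain ⟨v, hv, hv0⟩ := (Submodule.ne_bot_iff _).1 (hfin.mem_toFinset.1 hμ)
    have h := hpow e μ v hv
    rw [hA, Module.End.one_apply] at h
    have h' : (μ ^ e - 1) • v = 0 := by rw [sub_smul, one_smul, ← h, sub_self]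
    exact sub_eq_zero.1 ((smul_eq_zero.1 h').resolve_right hv0)
  · intro k
    have hmaps : ∀ μ, Set.MapsTo (A ^ k) (A.eigenspace μ) (A.eigenspace μ) := by
      intro μ v hv
      have := hpow k μ v hv
      rw [this]
      exact Submodule.smul_mem _ _ hv
    rw [LinearMap.trace_eq_sum_trace_restrict' hint hfin hmaps]
    refine Finset.sum_congr rfl fun μ _ => ?_
    have : (A ^ k).restrict (hmaps μ) = μ ^ k • LinearMap.id := by
      ext v
      exact hpow k μ v v.2
    rw [this, map_smul, LinearMap.trace_id, smul_eq_mul, mul_comm]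

/-- A ring homomorphism raising the `e`-th roots of unity to the `r`-th power maps `χ(g)` to
`χ(g ^ r)`. -/
theorem exists_map_character_eq {H : Type*} [Group H] {V : Type*} [AddCommGroup V] [Module ℂ V]
    [FiniteDimensional ℂ V] (ρ : Representation ℂ H V) {e : ℕ} (he : 0 < e) (M : Subfield ℂ)
    (hM : ∀ μ : ℂ, μ ^ e = 1 → μ ∈ M) (f : M →+* ℂ) {r : ℕ}
    (hf : ∀ μ : M, μ ^ e = 1 → f μ = (μ : ℂ) ^ r) {g : H} (hg : g ^ e = 1) :
    ∃ t : M, (t : ℂ) = ρ.character g ∧ f t = ρ.character (g ^ r) := by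
  obtain ⟨S, a, hS, htr⟩ := trace_pow_eq_sum (ρ g) he (by rw [← map_pow, hg, map_one])
  have hchar : ∀ k : ℕ, ρ.character (g ^ k) = ∑ μ ∈ S, (a μ : ℂ) * μ ^ k := by
    intro k
    rw [← htr, ← map_pow]
    rfl
  refine ⟨∑ μ ∈ S.attach, (a μ : M) * ⟨μ, hM μ (hS μ μ.2)⟩, ?_, ?_⟩
  · have := hchar 1
    rw [pow_one] at this
    rw [this, ← Finset.sum_attach S]
    simp
  · rw [hchar, map_sum, ← Finset.sum_attach S]
    refine Finset.sum_congr rfl fun μ _ => ?_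
    rw [map_mul, map_natCast, hf _ (Subtype.ext (hS μ μ.2))]

/-- An element of a cyclotomic extension of `K` lies in `K` if it is fixed by the Galois group;
an element of the Galois group acts on roots of unity as a power map. -/
theorem mem_of_forall_map_eq (K : IntermediateField ℚ ℂ) {e : ℕ} (he : 0 < e) (b : ℂ)
    (hb : ∀ (M : Subfield ℂ) (f : M →+* ℂ) (r : ℕ), (∀ μ : ℂ, μ ^ e = 1 → μ ∈ M) →
      r.Coprime e → (∀ μ : M, μ ^ e = 1 → f μ = (μ : ℂ) ^ r) →
      (∀ x : M, (x : ℂ) ∈ K → f x = x) → ∃ t : M, (t : ℂ) = b ∧ f t = b) :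
    b ∈ K := by
  have : NeZero e := ⟨he.ne'⟩
  have hζ := Complex.isPrimitiveRoot_exp e he.ne'
  set ζ := Complex.exp (2 * Real.pi * Complex.I / e)
  let M : IntermediateField K ℂ :=
    IntermediateField.adjoin K {b : ℂ | ∃ n ∈ ({e} : Set ℕ), n ≠ 0 ∧ b ^ n = 1}
  have hM : ∀ μ : ℂ, μ ^ e = 1 → μ ∈ M := fun μ hμ =>
    IntermediateField.subset_adjoin _ _ ⟨e, rfl, he.ne', hμ⟩
  have : IsCyclotomicExtension {e} K M :=
    IntermediateField.isCyclotomicExtension_adjoin_of_exists_isPrimitiveRoot {e} K ℂ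
      (by rintro n rfl -; exact ⟨ζ, hζ⟩)
  have := IsCyclotomicExtension.isGalois {e} K M
  have := IsCyclotomicExtension.finiteDimensional {e} K M
  have key : ∀ σ : M ≃ₐ[K] M, ∃ t : M, (t : ℂ) = b ∧ (σ t : ℂ) = b := by
    intro σ
    have hζM : IsPrimitiveRoot (⟨ζ, hM ζ hζ.pow_eq_one⟩ : M) e :=
      IsPrimitiveRoot.of_map_of_injective (f := M.val) hζ M.val.injective
    obtain ⟨r, -, hr, hσ⟩ := hζM.isPrimitiveRoot_iff.1
      (hζM.map_of_injective (f := σ) σ.injective)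
    refine hb M.toSubfield (M.val.toRingHom.comp σ.toRingEquiv.toRingHom) r hM hr ?_ ?_
    · intro μ hμ
      obtain ⟨i, -, rfl⟩ := hζM.eq_pow_of_pow_eq_one hμ
      change ((σ ((⟨ζ, hM ζ hζ.pow_eq_one⟩ : M) ^ i) : M) : ℂ) = _
      rw [map_pow, ← hσ, ← pow_mul, mul_comm, pow_mul]
      rfl
    · intro x hx
      exact congrArg Subtype.val (σ.commutes ⟨x, hx⟩)
  -- The identity automorphism serves only to place `b` in `M`.
  obtain ⟨t, ht, -⟩ := key AlgEquiv.refl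
  obtain ⟨y, hy⟩ := (IsGalois.mem_range_algebraMap_iff_fixed t).2 (by
    intro σ
    obtain ⟨t', ht', h⟩ := key σ
    rw [Subtype.ext (ht'.trans ht.symm)] at h
    exact Subtype.ext (h.trans ht.symm))
  rw [← ht, ← hy]
  exact y.2

end GaloisAction

/-! ### Character sums over `m`-th roots -/

section PowerSums

variable {H : Type*} [Group H] {n : ℕ} {ρ : Representation ℂ H (Fin n → ℂ)}

theorem exists_eq_smul_id_of_commute (hρ : ρ.IsIrreducible) (A : Module.End ℂ (Fin n → ℂ))
    (hA : ∀ t, A * ρ t = ρ t * A) : ∃ c : ℂ, A = c • LinearMap.id := by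
  let T : Representation.IntertwiningMap ρ ρ := { toLinearMap := A, isIntertwining' := hA }
  obtain ⟨c, hc⟩ :=
    (Representation.IsIrreducible.algebraMap_intertwiningMap_bijective_of_isAlgClosed
      (ρ := ρ)).2 T
  exact ⟨c, (congrArg Representation.IntertwiningMap.toLinearMap hc).symm⟩

theorem dim_ne_zero (hρ : ρ.IsIrreducible) : n ≠ 0 := by
  have h1 := Representation.IsIrreducible.finrank_intertwiningMap_self ρ
  rintro rfl
  have : Subsingleton (Representation.IntertwiningMap ρ ρ) :=
    ⟨fun a b => by ext v i; exact i.elim0⟩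
  rw [Module.finrank_zero_of_subsingleton] at h1
  omega

/-- By Schur's lemma the central `c` acts as a scalar `w`, nonzero because `χ(1) ≠ 0`. -/
theorem exists_character_mul_central (hρ : ρ.IsIrreducible) {c : H}
    (hc : c ∈ Subgroup.center H) :
    ∃ w : ℂ, w ≠ 0 ∧ (∀ x, ρ.character (x * c) = w * ρ.character x) ∧
      ∀ x, ρ.character (x * c)⁻¹ = w⁻¹ * ρ.character x⁻¹ := by
  have hcomm : ∀ t, c * t = t * c := fun t => (Subgroup.mem_center_iff.1 hc t).symm
  obtain ⟨w, hw⟩ := exists_eq_smul_id_of_commute hρ (ρ c) (fun t => by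
    rw [← map_mul, ← map_mul, hcomm])
  have hmul : ∀ x, ρ.character (x * c) = w * ρ.character x := by
    intro x
    change LinearMap.trace ℂ _ (ρ (x * c)) = w * LinearMap.trace ℂ _ (ρ x)
    rw [map_mul, hw, ← smul_eq_mul w, ← map_smul]
    congr 1
    ext
    simp
  have hw0 : w ≠ 0 := by
    rintro rfl
    have h := hmul c⁻¹
    rw [inv_mul_cancel, ρ.char_one, zero_mul] at h
    exact dim_ne_zero hρ (by simpa using h)
  refine ⟨w, hw0, hmul, fun x => ?_⟩
  have h := hmul (x * c)⁻¹
  rw [eq_inv_mul_iff_mul_eq₀ hw0, ← h, mul_inv_rev, ← hcomm, mul_inv_cancel_left]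

variable [Fintype H] [DecidableEq H]

/-- The set of `m`-th roots of `w`. -/
def zpowRoots (m : ℤ) (w : H) : Finset H := Finset.univ.filter fun x => x ^ m = w

theorem mem_zpowRoots {m : ℤ} {w x : H} : x ∈ zpowRoots m w ↔ x ^ m = w := by
  simp [zpowRoots]

variable (ρ) in
/-- The product of the sums of `χ(x)` and of `χ(x⁻¹)` over the `m`-th roots `x` of `w`. -/
def rootNorm (m : ℤ) (w : H) : ℂ :=
  (∑ x ∈ zpowRoots m w, ρ.character x) * ∑ x ∈ zpowRoots m w, ρ.character x⁻¹

theorem rootNorm_inv (m : ℤ) (w : H) : rootNorm ρ m w⁻¹ = rootNorm ρ m w := by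
  have h : ∀ F : H → ℂ, ∑ x ∈ zpowRoots m w⁻¹, F x = ∑ x ∈ zpowRoots m w, F x⁻¹ := by
    intro F
    refine Finset.sum_nbij' (fun x => x⁻¹) (fun x => x⁻¹) ?_ ?_ ?_ ?_ ?_ <;>
      simp +contextual [mem_zpowRoots]
  rw [rootNorm, h, h, rootNorm, mul_comm]
  simp

/-- Translation by `c` maps the roots of `w` onto those of `w * c ^ m`; the two factors pick up
scalars `a` and `a⁻¹`, which cancel. -/
theorem rootNorm_mul_zpow (hρ : ρ.IsIrreducible) (m : ℤ) (w : H) {c : H}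
    (hc : c ∈ Subgroup.center H) : rootNorm ρ m (w * c ^ m) = rootNorm ρ m w := by
  have hcomm : ∀ t, Commute t c := fun t => Subgroup.mem_center_iff.1 hc t
  have h : ∀ F : H → ℂ,
      ∑ x ∈ zpowRoots m (w * c ^ m), F x = ∑ x ∈ zpowRoots m w, F (x * c) := by
    intro F
    symm
    refine Finset.sum_nbij' (fun x => x * c) (fun x => x * c⁻¹) ?_ ?_ ?_ ?_ ?_
    · intro x hx
      rw [mem_zpowRoots] at hx ⊢
      rw [(hcomm x).mul_zpow, hx]
    · intro x hx
      rw [mem_zpowRoots] at hx ⊢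
      rw [(hcomm x).inv_right.mul_zpow, hx, inv_zpow, mul_inv_cancel_right]
    all_goals simp
  obtain ⟨a, ha0, ha, ha'⟩ := exists_character_mul_central hρ hc
  rw [rootNorm, h, h]
  simp only [ha, ha', ← Finset.mul_sum]
  rw [rootNorm]
  field_simp

/-- The sum of an irreducible character over the quotients of `m`-th roots of a central element. -/
theorem sum_zpowRoots_character_div (hρ : ρ.IsIrreducible) (m : ℤ) {z : H}
    (hz : z ∈ Subgroup.center H) :
    ∑ x ∈ zpowRoots m z, ∑ y ∈ zpowRoots m z, ρ.character (x * y⁻¹) =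
      (n : ℂ)⁻¹ * rootNorm ρ m z := by
  have hzt : ∀ t, t * z * t⁻¹ = z := fun t => by
    rw [Subgroup.mem_center_iff.1 hz t, mul_inv_cancel_right]
  -- Conjugation permutes the roots of the central `z`, so this operator commutes with `ρ`.
  obtain ⟨c, hc⟩ := exists_eq_smul_id_of_commute hρ (∑ y ∈ zpowRoots m z, ρ y⁻¹) (by
    intro t
    rw [Finset.sum_mul, Finset.mul_sum]
    refine Finset.sum_nbij' (fun y => t⁻¹ * y * t) (fun y => t * y * t⁻¹) ?_ ?_ ?_ ?_ ?_
    · intro y hy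
      rw [mem_zpowRoots] at hy ⊢
      have := conj_zpow (a := t⁻¹) (b := y) (i := m)
      rw [inv_inv] at this
      rw [this, hy]
      simpa using hzt t⁻¹
    · intro y hy
      rw [mem_zpowRoots] at hy ⊢
      rw [conj_zpow, hy, hzt]
    · intro y _
      group
    · intro y _
      group
    · intro y _
      rw [← map_mul, ← map_mul]
      congr 1
      group)
  have hn : (n : ℂ) ≠ 0 := by exact_mod_cast dim_ne_zero hρ
  have htr : ∑ y ∈ zpowRoots m z, ρ.character y⁻¹ = c * n := by
    have := congrArg (LinearMap.trace ℂ (Fin n → ℂ)) hc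
    rw [map_sum, map_smul, LinearMap.trace_id] at this
    rw [Module.finrank_fin_fun, smul_eq_mul] at this
    exact this
  have hx : ∀ x, ∑ y ∈ zpowRoots m z, ρ.character (x * y⁻¹) = c * ρ.character x := by
    intro x
    have := congrArg (fun B => LinearMap.trace ℂ (Fin n → ℂ) (ρ x * B)) hc
    simp only [Finset.mul_sum, map_sum, ← map_mul, mul_smul_comm, map_smul] at this
    exact this
  simp only [hx, ← Finset.mul_sum]
  rw [rootNorm, htr]
  field_simp

theorem sum_zpowRoots_pow {m : ℤ} {z : H} {r s : ℕ} (hrs : ∀ x : H, x ^ (r * s) = x)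
    (F : H → ℂ) : ∑ x ∈ zpowRoots m z, F (x ^ r) = ∑ x ∈ zpowRoots m (z ^ r), F x := by
  refine Finset.sum_nbij' (fun x => x ^ r) (fun x => x ^ s) ?_ ?_ ?_ ?_ ?_
  · intro x hx
    rw [mem_zpowRoots] at hx ⊢
    rw [← hx, ← zpow_natCast, ← zpow_natCast, ← zpow_mul, ← zpow_mul, mul_comm]
  · intro x hx
    rw [mem_zpowRoots] at hx ⊢
    rw [← zpow_natCast, ← zpow_mul, mul_comm, zpow_mul, hx, zpow_natCast, ← pow_mul, hrs]
  · intro x _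
    rw [← pow_mul, hrs]
  · intro x _
    rw [← pow_mul, mul_comm, hrs]
  · intro x _
    rfl

end PowerSums

/-! ### Fields containing `rootNorm` -/

section Rationality

variable {H : Type*} [Group H] [Fintype H] [DecidableEq H] {n : ℕ}
  {ρ : Representation ℂ H (Fin n → ℂ)}

/-- Galois descent: the hypothesis on `r` records what fixing `K` says about roots of unity, and the
conjugate of `rootNorm` at `z` is `rootNorm` at `z ^ r`. -/
theorem rootNorm_mem (K : IntermediateField ℚ ℂ) (m : ℤ) (z : H)
    (h : ∀ r : ℕ, r.Coprime (Monoid.exponent H) →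
      (∀ μ ∈ K, μ ^ Monoid.exponent H = 1 → μ ^ r = μ) →
        rootNorm ρ m (z ^ r) = rootNorm ρ m z) :
    rootNorm ρ m z ∈ K := by
  have he : 0 < Monoid.exponent H := Monoid.exponent_pos.2 Monoid.ExponentExists.of_finite
  refine mem_of_forall_map_eq K he _ fun M f r hM hr hf hK => ?_
  -- With `s` inverse to `r` modulo the exponent, `x ↦ x ^ s` inverts `x ↦ x ^ r`.
  obtain ⟨s, -, hs⟩ := Nat.exists_mul_mod_eq_of_coprime 1 hr he.ne'
  have hrs : ∀ x : H, x ^ (r * s) = x := fun x => by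
    conv_rhs => rw [← pow_one x]
    exact pow_eq_pow_iff_modEq.2 (Nat.ModEq.of_dvd (Monoid.order_dvd_exponent x) hs)
  choose τ hτ hfτ using fun g : H =>
    exists_map_character_eq ρ he M hM f hf (Monoid.pow_exponent_eq_one g)
  refine ⟨(∑ x ∈ zpowRoots m z, τ x) * ∑ x ∈ zpowRoots m z, τ x⁻¹, ?_, ?_⟩
  · simp [hτ, rootNorm]
  · rw [← h r hr fun μ hμ hμe => ?_]
    · simp only [map_mul, map_sum, hfτ, inv_pow]
      rw [sum_zpowRoots_pow hrs, sum_zpowRoots_pow hrs fun x => ρ.character x⁻¹, rootNorm]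
    · rw [← hf ⟨μ, hM μ hμe⟩ (Subtype.ext hμe), hK _ hμ]

theorem rootNorm_pow (hρ : ρ.IsIrreducible) (m : ℤ) {z : H} (hz : z ∈ Subgroup.center H) {r : ℕ}
    (hr : (Int.gcd (orderOf z) m : ℤ) ∣ r - 1 ∨ (Int.gcd (orderOf z) m : ℤ) ∣ r + 1) :
    rootNorm ρ m (z ^ r) = rootNorm ρ m z := by
  have key : ∀ k : ℤ, (Int.gcd (orderOf z) m : ℤ) ∣ k →
      ∃ c ∈ Subgroup.center H, z ^ k = c ^ m := by
    rintro _ ⟨q, rfl⟩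
    -- From `gcd = o(z) * a + m * b`, the `o(z)` term dies and `c = z ^ (b * q)`.
    refine ⟨z ^ (Int.gcdB (orderOf z) m * q), Subgroup.zpow_mem _ hz _, ?_⟩
    rw [Int.gcd_eq_gcd_ab, add_mul, zpow_add, mul_assoc, zpow_mul, zpow_natCast,
      pow_orderOf_eq_one, one_zpow, one_mul, ← zpow_mul]
    congr 1
    ring
  rcases hr with hr | hr
  · obtain ⟨c, hc, h⟩ := key _ hr
    rw [← rootNorm_mul_zpow hρ m z hc, ← h, ← zpow_one_add, add_sub_cancel, zpow_natCast]
  · obtain ⟨c, hc, h⟩ := key _ hr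
    rw [← rootNorm_inv m z, ← rootNorm_mul_zpow hρ m z⁻¹ hc, ← h, ← zpow_neg_one, ← zpow_add,
      neg_add_cancel_comm_assoc, zpow_natCast]

theorem rootNorm_mem_cyclotomicField (hρ : ρ.IsIrreducible) (m : ℤ) {z : H}
    (hz : z ∈ Subgroup.center H) :
    rootNorm ρ m z ∈ cyclotomicField (Int.gcd (orderOf z) m) := by
  refine rootNorm_mem _ m z fun r _ hK => rootNorm_pow hρ m hz (Or.inl ?_)
  set d := Int.gcd (orderOf z) m with hd
  have hdo : d ∣ orderOf z := Int.natCast_dvd_natCast.1 (Int.gcd_dvd_left _ _)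
  have hd0 : d ≠ 0 := fun h => (orderOf_pos z).ne' (Nat.eq_zero_of_zero_dvd (h ▸ hdo))
  have hζ := Complex.isPrimitiveRoot_exp d hd0
  -- As `d ∣ o(z) ∣ exp(H)`, `hK` applies to `ζ_d`: `ζ_d ^ r = ζ_d`, so `d ∣ r - 1`.
  have h := hK _ (IntermediateField.subset_adjoin _ _ rfl)
    (hζ.pow_eq_one_iff_dvd _ |>.2 (hdo.trans (Monoid.order_dvd_exponent z)))
  rw [← hζ.zpow_eq_one_iff_dvd, zpow_sub_one₀ (Complex.exp_ne_zero _), zpow_natCast, h,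
    mul_inv_cancel₀ (Complex.exp_ne_zero _)]

theorem exists_rat_eq_rootNorm (hρ : ρ.IsIrreducible) (m : ℤ) {z : H}
    (hz : z ∈ Subgroup.center H)
    (hd : Int.gcd (orderOf z) m ∈ ({1, 2, 3, 4, 6} : Set ℕ)) :
    ∃ q : ℚ, rootNorm ρ m z = (q : ℂ) := by
  suffices rootNorm ρ m z ∈ (⊥ : IntermediateField ℚ ℂ) by
    obtain ⟨q, hq⟩ := IntermediateField.mem_bot.1 this
    exact ⟨q, hq.symm⟩
  refine rootNorm_mem _ m z fun r hr _ => rootNorm_pow hρ m hz ?_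
  have hdo : Int.gcd (orderOf z) m ∣ orderOf z :=
    Int.natCast_dvd_natCast.1 (Int.gcd_dvd_left _ _)
  replace hr := hr.coprime_dvd_right (hdo.trans (Monoid.order_dvd_exponent z))
  generalize Int.gcd (orderOf z) m = d at hd hr
  have hgcd : ∀ p, p ≠ 1 → d % p ≠ 0 ∨ r % p ≠ 0 := by
    intro p h1
    by_contra! hp
    exact h1 (Nat.eq_one_of_dvd_one (hr ▸ Nat.dvd_gcd (Nat.dvd_of_mod_eq_zero hp.2)
      (Nat.dvd_of_mod_eq_zero hp.1)))
  have h2 := hgcd 2 (by norm_num)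
  have h3 := hgcd 3 (by norm_num)
  rcases hd with rfl | rfl | rfl | rfl | rfl
  iterate 4 omega
  -- A unit mod 6 is odd and prime to 3, hence `±1`.
  have h6 : r % 6 = 1 ∨ r % 6 = 5 := by
    have := Nat.mod_lt r (show 0 < 6 by norm_num)
    have := Nat.mod_mod_of_dvd r (show 2 ∣ 6 by norm_num)
    have := Nat.mod_mod_of_dvd r (show 3 ∣ 6 by norm_num)
    generalize r % 6 = k at *
    interval_cases k <;> omega
  omega

end Rationality

/-! ### From `beta` to `rootNorm` -/

section Coefficients

theorem irrBasis_repr_eq_pairing {H : Type*} [Group H] [Fintype H] (f : ClassFunction H)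
    (χ : Irr H) : (irrBasis H).repr f χ = pairing χ.1 f.1 := by
  classical
  have h : (irrBasis H).coord χ = (pairing χ.1).comp (ClassFunction H).subtype := by
    refine (irrBasis H).ext fun ψ => ?_
    rw [Module.Basis.coord_apply, Module.Basis.repr_self, Finsupp.single_apply, irrBasis,
      Module.Basis.mk_apply]
    exact (pairing_irr ψ χ).symm
  exact congrArg (fun L => L f) h

/-- Substitute `y = g * x`, so that `g⁻¹ = x * y⁻¹`. -/
theorem sum_card_mul_inv {H R : Type*} [Group H] [Fintype H] [DecidableEq H] [CommSemiring R]
    (T : Finset H) (F : H → R) :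
    ∑ g : H, ((T.filter fun x => g * x ∈ T).card : R) * F g⁻¹ =
      ∑ x ∈ T, ∑ y ∈ T, F (x * y⁻¹) := by
  simp only [Finset.card_filter, Nat.cast_sum, Finset.sum_mul]
  rw [Finset.sum_comm]
  refine Finset.sum_congr rfl fun x _ => ?_
  rw [← Fintype.sum_ite_mem T]
  refine Fintype.sum_equiv (Equiv.mulRight x) _ _ fun g => ?_
  simp

variable {G : Type*} [Group G]

/-- No roots are lost in passing to the centralizer: `x` commutes with `x ^ m = z`. -/
theorem gammaFun_apply_eq_card (m : ℤ) (z : G) [Fintype (Subgroup.centralizer {z})]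
    [DecidableEq (Subgroup.centralizer {z})] (w : Subgroup.centralizer {z}) (hw : (w : G) = z)
    (g : Subgroup.centralizer {z}) :
    (gammaFun m z).1 g =
      (((zpowRoots m w).filter fun x => g * x ∈ zpowRoots m w).card : ℂ) := by
  have hiff : ∀ x : Subgroup.centralizer {z}, (x : G) ^ m = z ↔ x ^ m = w := fun x => by
    rw [Subtype.ext_iff, Subgroup.coe_zpow, hw]
  have hcent : ∀ x : G, x ^ m = z → x ∈ Subgroup.centralizer {z} := by
    rintro x hx
    rw [Subgroup.mem_centralizer_singleton_iff, ← hx]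
    exact (Commute.self_zpow x m).eq
  change (Nat.card (powSet m (g : G) z) : ℂ) = _
  have hset : powSet m (g : G) z = (((zpowRoots m w).filter fun x => g * x ∈ zpowRoots m w).map
      (Function.Embedding.subtype _) : Finset G) := by
    ext x
    simp only [powSet, Set.mem_ofPred_eq, Finset.coe_map, Function.Embedding.subtype_apply,
      Set.mem_image, Finset.mem_coe, Finset.mem_filter, mem_zpowRoots, ← hiff, Subgroup.coe_mul]
    exact ⟨fun h => ⟨⟨x, hcent x h.1⟩, h, rfl⟩, by rintro ⟨y, h, rfl⟩; exact h⟩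
  rw [Nat.card_coe_set_eq, hset, Set.ncard_coe_finset, Finset.card_map]

theorem beta_eq_rootNorm [Finite G] (m : ℤ) (z : G) [Fintype (Subgroup.centralizer {z})]
    [DecidableEq (Subgroup.centralizer {z})] (w : Subgroup.centralizer {z}) (hw : (w : G) = z)
    (hwc : w ∈ Subgroup.center (Subgroup.centralizer {z}))
    (χ : Irr (Subgroup.centralizer {z})) {n : ℕ}
    (ρ : Representation ℂ (Subgroup.centralizer {z}) (Fin n → ℂ)) (hρ : ρ.IsIrreducible)
    (hχ : χ.1 = ρ.character) :
    beta m z χ =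
      (((Nat.card (Subgroup.centralizer {z}) : ℚ)⁻¹ * (n : ℚ)⁻¹ : ℚ) : ℂ) * rootNorm ρ m w := by
  rw [beta, irrBasis_repr_eq_pairing]
  change (Nat.card _ : ℂ)⁻¹ * ∑ g, (gammaFun m z).1 g * χ.1 g⁻¹ = _
  simp only [gammaFun_apply_eq_card m z w hw, sum_card_mul_inv, hχ]
  rw [sum_zpowRoots_character_div hρ m hwc]
  push_cast
  ring

end Coefficients

end FSIndicator

end

theorem mainTheorem9 {G : Type*} [Group G] [Finite G] (z : G)
    (χ : FSIndicator.Irr (Subgroup.centralizer {z})) (m : ℤ)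
    (hm : m ∣ ((Monoid.exponent (Subgroup.centralizer {z}) / orderOf z : ℕ) : ℤ)) :
    FSIndicator.beta m z χ ∈ FSIndicator.cyclotomicField (Int.gcd (orderOf z) m) ∧
      (Int.gcd (orderOf z) m ∈ ({1, 2, 3, 4, 6} : Set ℕ) →
        ∃ q : ℚ, FSIndicator.beta m z χ = (q : ℂ)) := by
  classical
  have := Fintype.ofFinite (Subgroup.centralizer {z})
  obtain ⟨n, ρ, hρ, hχ⟩ := χ.2
  let w : Subgroup.centralizer {z} := ⟨z, Subgroup.mem_centralizer_singleton_iff.2 rfl⟩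
  have hwc : w ∈ Subgroup.center (Subgroup.centralizer {z}) :=
    Subgroup.mem_center_iff.2 fun t => Subtype.ext (Subgroup.mem_centralizer_singleton_iff.1 t.2)
  have ho : orderOf z = orderOf w := (Subgroup.orderOf_coe w)
  rw [FSIndicator.beta_eq_rootNorm m z w rfl hwc χ ρ hρ hχ, ho]
  refine ⟨?_, fun hd => ?_⟩
  · exact mul_mem (SubfieldClass.ratCast_mem _ _)
      (FSIndicator.rootNorm_mem_cyclotomicField hρ m hwc)
  · obtain ⟨q, hq⟩ := FSIndicator.exists_rat_eq_rootNorm hρ m hwc hd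
    exact ⟨_ * q, by rw [hq, ← Rat.cast_mul]⟩
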